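/- Let $d\ge 0$. A \emph{polyhedral cone} in $\mathbb R^d$ is an intersection of finitely many closed half-spaces of the form $\{x : \langle a,x\rangle\le 0\}$; let $\mathcal P(\mathbb R^d)$ be the set of polyhedral cones. Let $\hat{\mathcal B}(\mathbb R^d)$ be the $\sigma$-algebra of \emph{conic Borel sets}, i.e. Borel sets $M\subseteq\mathbb R^d$ with $\lambda M=M$ for all $\lambda>0$, and call a $\sigma$-additive function $\hat{\mathcal B}(\mathbb R^d)\to\mathbb R$ a \emph{conic measure}. A \emph{face} of $C\in\mathcal P(\mathbb R^d)$ is a set $\{x\in C : \langle x,z\rangle=0\}$ with $z\in\mathbb R^d$ such that $\langle x,z\rangle\le 0$ for all $x\in C$. Let $\mathcal L_k(C)$ be the (finite) set of $k$-dimensional linear spans of faces of $C$, and let $S_k(C)=\bigcup_{L\in\mathcal L_k(C)}\operatorname{int}_L(C\cap L)$ be the $k$-skeleton of $C$, where $\operatorname{int}_L$ is the interior relative to $L$. With $\Delta$ the Dirac measure at $0$ and $\gamma_L$ the standard Gaussian measure on a linear subspace $L$ (so $\gamma_{\{0\}}=\Delta$), define for $0\le k\le d$, $C\in\mathcal P(\mathbb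 R^d)$ and $M\in\hat{\mathcal B}(\mathbb R^d)$ the \emph{lineality measures} and the \emph{polyhedral measures} $$\operatorname{Lin}_k(C,M)=\begin{cases}\Delta(M)&\text{if }\dim(C\cap(-C))=k,\\0&\text{otherwise,}\end{cases}\qquad \Psi_k(C,M)=\sum_{L\in\mathcal L_k(C)}\gamma_L(C\cap L\cap M).$$ \textbf{Theorem (Characterization of polyhedral measures).} Let $\psi\colon\mathcal P(\mathbb R^d)\times\hat{\mathcal B}(\mathbb R^d)\to\mathbb R$ be such that for all $C,D\in\mathcal P(\mathbb R^d)$, $M\in\hat{\mathcal B}(\mathbb R^d)$ and all orthogonal transformations $Q\in O(d)$: \begin{enumerate} \item[(0)] $\psi(C,\cdot)$ is a conic measure; \item[(1)] $\psi(C,M)=\psi(C,M\cap C)$; \item[(2)] $\psi(QC,QM)=\psi(C,M)$; \item[(3)] $\psi(C,M)=\psi(D,M)$ if $S_k(C)\cap M=S_k(D)\cap M$ for $k=0,\dots,d$. \end{enumerate} Then $\psi$ is a linear combination of $\operatorname{Lin}_d,\dots,\operatorname{Lin}_1,\operatorname{Lin}_0=\Psi_0,\Psi_1,\dots,\Psi_d$.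 Explicitly, $$\psi=\sum_{k=0}^d\psi(L^{(k)},\{0\})\,\operatorname{Lin}_k+\sum_{k=1}^d\psi(L^{(k)},\mathbb R^d\setminus\{0\})\,\Psi_k,$$ where, for each $k$, $L^{(k)}\subseteq\mathbb R^d$ is any $k$-dimensional linear subspace. -/

import Mathlib

open MeasureTheory ProbabilityTheory
open scoped Pointwise

noncomputable section

namespace Conic

/-- The Euclidean space `ℝ^d`. -/
abbrev E (d : ℕ) : Type := EuclideanSpace ℝ (Fin d)

/-! ### Polyhedral cones -/

/-- Polyhedral cones in `ℝ^d`: intersections of finitely many closed half-spaces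
`{y | 0 ≤ ⟪x, y⟫}`. -/
def PolyhedralCone (d : ℕ) : Type :=
  {C : PointedCone ℝ (E d) // C.DualFG (innerₗ (E d))}

namespace PolyhedralCone

variable {d : ℕ}

/-- The underlying set of a polyhedral cone. -/
def carrier (C : PolyhedralCone d) : Set (E d) := (C.1 : Set (E d))

theorem exists_halfspaces (C : PolyhedralCone d) :
    ∃ s : Finset (E d), ∀ y, y ∈ C.carrier ↔ ∀ x ∈ s, 0 ≤ inner ℝ x y := by
  obtain ⟨s, hs⟩ := C.2
  refine ⟨s, fun y => ?_⟩
  simp [carrier, ← hs, PointedCone.mem_dual]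

theorem isClosed_carrier (C : PolyhedralCone d) : IsClosed C.carrier := by
  obtain ⟨s, hs⟩ := C.exists_halfspaces
  have : C.carrier = ⋂ x ∈ s, {y | 0 ≤ inner ℝ x y} := by
    ext y; simp [hs]
  rw [this]
  exact isClosed_biInter fun x _ => isClosed_le continuous_const (by fun_prop)

/-- A linear subspace, seen as a polyhedral cone. -/
def ofSubspace (L : Submodule ℝ (E d)) : PolyhedralCone d :=
  ⟨PointedCone.ofSubmodule L, by
    classical
    obtain ⟨t, ht⟩ := (IsNoetherian.noetherian Lᗮ : (Lᗮ).FG)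
    refine ⟨t ∪ t.image (fun x => -x), ?_⟩
    ext y
    rw [PointedCone.mem_ofSubmodule_iff, ← Submodule.orthogonal_orthogonal L, ← ht,
      Submodule.mem_orthogonal]
    constructor
    · intro h u hu
      induction hu using Submodule.span_induction with
      | mem x hx =>
        have h1 : 0 ≤ inner ℝ x y := by
          have := PointedCone.mem_dual.1 h (x := x) (by simp [Finset.mem_coe.1 hx])
          simpa using this
        have h2 : 0 ≤ inner ℝ (-x) y := by
          have := PointedCone.mem_dual.1 h (x := -x) (by simp [Finset.mem_coe.1 hx])
          simpa using this
        rw [inner_neg_left] at h2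
        linarith
      | zero => simp
      | add a b _ _ ha hb => rw [inner_add_left, ha, hb, add_zero]
      | smul r a _ ha => rw [inner_smul_left, ha, mul_zero]
    · intro h
      refine PointedCone.mem_dual.2 fun x hx => ?_
      have key : inner ℝ x y = 0 := by
        have hx' : x ∈ t ∨ -x ∈ t := by
          simpa [neg_eq_iff_eq_neg] using hx
        rcases hx' with hx' | hx'
        · exact h x (Submodule.subset_span hx')
        · have := h (-x) (Submodule.subset_span hx')
          rwa [inner_neg_left, neg_eq_zero] at this
      simp [key]⟩

/-- The image `Q C` of a polyhedral cone under an orthogonal transformation. -/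
def rotate (Q : E d ≃ₗᵢ[ℝ] E d) (C : PolyhedralCone d) : PolyhedralCone d :=
  ⟨C.1.map (Q.toLinearEquiv : E d →ₗ[ℝ] E d), by
    classical
    obtain ⟨s, hs⟩ := C.2
    refine ⟨s.image Q, ?_⟩
    ext y
    rw [PointedCone.mem_map, ← hs]
    simp only [PointedCone.mem_dual]
    constructor
    · intro h
      refine ⟨Q.symm y, fun x hx => ?_, by simp⟩
      have := h (x := Q x) (by simpa using hx)
      simpa [← Q.inner_map_map x (Q.symm y)] using this
    · rintro ⟨x, hx, rfl⟩ z hz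
      obtain ⟨w, hw, rfl⟩ : ∃ w ∈ s, Q w = z := by simpa using hz
      simpa using hx hw⟩

/-- `F` is a face of `C`: it is cut out of `C` by a supporting hyperplane
(or `F = C`, with `z = 0`). -/
def IsFace (C : PolyhedralCone d) (F : Set (E d)) : Prop :=
  ∃ z : E d, (∀ x ∈ C.carrier, inner ℝ x z ≤ 0) ∧ F = {x ∈ C.carrier | inner ℝ x z = 0}

/-- `𝓛_k(C)`: the `k`-dimensional linear spans of faces of `C`. -/
def faceSpans (C : PolyhedralCone d) (k : ℕ) : Set (Submodule ℝ (E d)) :=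
  {L | (∃ F, C.IsFace F ∧ L = Submodule.span ℝ F) ∧ Module.finrank ℝ L = k}

/-- The interior of `A ∩ L` relative to the linear subspace `L`. -/
def relInterior (L : Submodule ℝ (E d)) (A : Set (E d)) : Set (E d) :=
  ((↑) : L → E d) '' interior (((↑) : L → E d) ⁻¹' A)

/-- The `k`-skeleton `S_k(C)`: the union of the relative interiors of the `k`-dimensional faces. -/
def skeleton (C : PolyhedralCone d) (k : ℕ) : Set (E d) :=
  ⋃ L ∈ C.faceSpans k, relInterior L C.carrier

/-- The lineality `dim (C ∩ -C)` of a cone. -/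
def lin (C : PolyhedralCone d) : ℕ := Module.finrank ℝ C.1.lineal

theorem finite_isFace (C : PolyhedralCone d) : {F | C.IsFace F}.Finite := by
  classical
  obtain ⟨s, hs⟩ := C.exists_halfspaces
  -- every face is cut out by turning some of the defining inequalities into equalities
  refine (s.powerset.finite_toSet.image
    (fun I : Finset (E d) => {y ∈ C.carrier | ∀ a ∈ I, inner ℝ a y = 0})).subset ?_
  rintro F ⟨z, hz, rfl⟩
  set F : Set (E d) := {x ∈ C.carrier | inner ℝ x z = 0} with hF
  set I : Finset (E d) := s.filter (fun a => ∀ y ∈ F, inner ℝ a y = 0) with hI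
  refine ⟨I, Finset.mem_coe.2 (Finset.mem_powerset.2 (Finset.filter_subset _ _)), ?_⟩
  -- a point of the face at which all the other inequalities are strict
  have hw : ∀ t ⊆ s \ I, ∃ x ∈ F, ∀ a ∈ t, 0 < inner ℝ a x := by
    intro t
    induction t using Finset.induction_on with
    | empty =>
      intro _
      exact ⟨0, ⟨(hs 0).2 (by simp), by simp⟩, by simp⟩
    | insert b t hb ih =>
      intro ht
      obtain ⟨x, hx, hxt⟩ := ih (fun a ha => ht (Finset.mem_insert_of_mem ha))
      have hbI := ht (Finset.mem_insert_self b t)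
      have : ∃ y ∈ F, inner ℝ b y ≠ 0 := by
        by_contra hcon
        push Not at hcon
        have h := Finset.mem_sdiff.1 hbI
        exact h.2 (Finset.mem_filter.2 ⟨h.1, hcon⟩)
      obtain ⟨y, hy, hby⟩ := this
      have hxs := (hs x).1 hx.1
      have hys := (hs y).1 hy.1
      refine ⟨x + y, ⟨(hs _).2 fun a ha => ?_, ?_⟩, fun a ha => ?_⟩
      · rw [inner_add_right]; exact add_nonneg (hxs a ha) (hys a ha)
      · rw [inner_add_left, hx.2, hy.2, add_zero]
      · rw [inner_add_right]
        rcases Finset.mem_insert.1 ha with rfl | ha'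
        · have hbs := (Finset.mem_sdiff.1 hbI).1
          exact add_pos_of_nonneg_of_pos (hxs _ hbs) (lt_of_le_of_ne (hys _ hbs) hby.symm)
        · exact add_pos_of_pos_of_nonneg (hxt a ha')
            (hys a (Finset.mem_sdiff.1 (ht (Finset.mem_insert_of_mem ha'))).1)
  obtain ⟨x, hx, hxp⟩ := hw (s \ I) subset_rfl
  ext y
  constructor
  · rintro ⟨hyC, hyI⟩
    refine ⟨hyC, le_antisymm (hz y hyC) ?_⟩
    -- a small step from `x` in direction `-y` stays in the cone
    have hev : ∀ᶠ ε : ℝ in nhds 0, ∀ a ∈ s \ I, 0 < inner ℝ a (x - ε • y) := by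
      rw [Filter.eventually_all_finset]
      intro a ha
      have hc : Continuous fun ε : ℝ => (inner ℝ a (x - ε • y) : ℝ) := by fun_prop
      exact hc.continuousAt.eventually (lt_mem_nhds (by simpa using hxp a ha))
    obtain ⟨ε, hε, hε0⟩ :=
      ((hev.filter_mono nhdsWithin_le_nhds).and
        (self_mem_nhdsWithin : Set.Ioi (0 : ℝ) ∈ nhdsWithin 0 (Set.Ioi 0))).exists
    have hmem : x - ε • y ∈ C.carrier := by
      refine (hs _).2 fun a ha => ?_
      by_cases haI : a ∈ I
      · rw [inner_sub_right, inner_smul_right, hyI a haI, (Finset.mem_filter.1 haI).2 x hx]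
        simp
      · exact (hε a (Finset.mem_sdiff.2 ⟨ha, haI⟩)).le
    have h := hz _ hmem
    rw [inner_sub_left, real_inner_smul_left, hx.2] at h
    have hε0' : 0 < ε := hε0
    by_contra hneg
    push Not at hneg
    nlinarith
  · intro hy
    exact ⟨hy.1, fun a ha => (Finset.mem_filter.1 ha).2 y hy⟩

theorem finite_faceSpans (C : PolyhedralCone d) (k : ℕ) : (C.faceSpans k).Finite := by
  refine (C.finite_isFace.image (fun F => Submodule.span ℝ F)).subset ?_
  rintro L ⟨⟨F, hF, rfl⟩, -⟩
  exact ⟨F, hF, rfl⟩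

end PolyhedralCone

/-! ### Conic Borel sets and conic measures -/

/-- The conic Borel `σ`-algebra: Borel sets `M` with `r M = M` for all `r > 0`. -/
@[reducible] def conicBorel (d : ℕ) : MeasurableSpace (E d) where
  MeasurableSet' M := MeasurableSet M ∧ ∀ r : ℝ, 0 < r → r • M = M
  measurableSet_empty := ⟨MeasurableSet.empty, fun r _ => Set.smul_set_empty⟩
  measurableSet_compl M hM :=
    ⟨hM.1.compl, fun r hr => by
      ext x
      rw [Set.mem_smul_set_iff_inv_smul_mem₀ hr.ne', Set.mem_compl_iff, Set.mem_compl_iff,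
        ← Set.mem_smul_set_iff_inv_smul_mem₀ hr.ne', hM.2 r hr]⟩
  measurableSet_iUnion f hf :=
    ⟨MeasurableSet.iUnion fun i => (hf i).1, fun r hr => by
      rw [Set.smul_set_iUnion]
      exact Set.iUnion_congr fun i => (hf i).2 r hr⟩

/-- Conic Borel sets in `ℝ^d`. -/
def ConicSet (d : ℕ) : Type := {M : Set (E d) // MeasurableSet[conicBorel d] M}

namespace ConicSet

variable {d : ℕ}

/-- The conic set `{0}`. -/
def origin (d : ℕ) : ConicSet d :=
  ⟨{0}, MeasurableSet.singleton 0, fun r _ => by simp⟩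

/-- The conic set `ℝ^d \ {0}`. -/
def punctured (d : ℕ) : ConicSet d :=
  ⟨{0}ᶜ, (origin d).2.compl⟩

/-- The conic set `M ∩ C`. -/
def interCone (M : ConicSet d) (C : PolyhedralCone d) : ConicSet d :=
  ⟨M.1 ∩ C.carrier, M.2.1.inter C.isClosed_carrier.measurableSet, fun r hr => by
    rw [Set.smul_set_inter₀ hr.ne', M.2.2 r hr]
    congr 1
    ext x
    rw [Set.mem_smul_set_iff_inv_smul_mem₀ hr.ne']
    constructor
    · intro h
      have := C.1.smul_mem hr.le h
      rwa [smul_inv_smul₀ hr.ne'] at this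
    · intro h
      exact C.1.smul_mem (inv_nonneg.2 hr.le) h⟩

/-- The image `Q M` of a conic set under an orthogonal transformation. -/
def rotate (Q : E d ≃ₗᵢ[ℝ] E d) (M : ConicSet d) : ConicSet d :=
  ⟨Q '' M.1, Q.toHomeomorph.toMeasurableEquiv.measurableSet_image.2 M.2.1, fun r hr => by
    conv_rhs => rw [← M.2.2 r hr]
    exact (Set.image_smul_comm Q r M.1 fun x => Q.map_smul r x).symm⟩

end ConicSet

/-- A conic measure: a `σ`-additive real-valued (signed) function on the conic Borel sets. -/
def IsConicMeasure {d : ℕ} (μ : ConicSet d → ℝ) : Prop :=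
  ∃ m : @SignedMeasure (E d) (conicBorel d), ∀ M : ConicSet d, μ M = m M.1

/-! ### Lineality measures and polyhedral measures -/

open Classical in
/-- The lineality measure `Lin_k(C, M)`, which is `Δ(M)` if `lin C = k` and `0` otherwise. -/
def linMeasure {d : ℕ} (k : ℕ) (C : PolyhedralCone d) (M : ConicSet d) : ℝ :=
  (if C.lin = k then 1 else 0) * (Measure.dirac (0 : E d)).real M.1

/-- The standard Gaussian measure `γ_L` on a linear subspace `L`, as a measure on `ℝ^d`. -/
def gaussianOn {d : ℕ} (L : Submodule ℝ (E d)) : Measure (E d) :=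
  (stdGaussian L).map ((↑) : L → E d)

/-- The polyhedral measure `Ψ_k(C, M) = ∑_{L ∈ 𝓛_k(C)} γ_L(C ∩ L ∩ M)`. -/
def polyMeasure {d : ℕ} (k : ℕ) (C : PolyhedralCone d) (M : ConicSet d) : ℝ :=
  ∑ L ∈ (C.finite_faceSpans k).toFinset, (gaussianOn L).real (C.carrier ∩ L ∩ M.1)

end Conic

end

/-!
The relative interiors of the faces of a cone `C` partition `C`. On the relative interior of a face
with span `L`, the skeletons of `C` and those of the cone `L` have the same traces, so there
`ψ(C, ·)` agrees with `ψ(L, ·)`. Away from the origin, `ψ(L, ·)` amounts to a signed measure on the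
unit sphere of `L` which is invariant under rotations, hence a multiple of the radial projection
of `γ_L`, with a factor depending only on `dim L`. The origin lies in the relative interior of the
lineality space of `C`, which accounts for the lineality measures.

The invariant measure on the sphere is unique because the characteristic function of an invariant
measure is radial: if `μ` and `ν` are both invariant and carried by the unit sphere, then
`∫ μ̂(r x) dν(x)` is `ν(S) μ̂(t)` for any `t` of norm `r`, and by Fubini this integral is symmetric
in `μ` and `ν`. Signed measures reduce to positive ones, since the uniqueness of the Jordan
decomposition makes it invariant too.
-/

noncomputable section

namespace Conic

/-! ### Rotation-invariant measures -/

section JordanDecomposition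

variable {α β : Type*} [MeasurableSpace α] [MeasurableSpace β]

/-- The image of a Jordan decomposition under a measurable equivalence; injectivity keeps the
positive and the negative part mutually singular. -/
def jordanMap (e : α ≃ᵐ β) (j : JordanDecomposition α) : JordanDecomposition β where
  posPart := j.posPart.map e
  negPart := j.negPart.map e
  mutuallySingular := e.measurableEmbedding.mutuallySingular_map j.mutuallySingular

theorem toSignedMeasure_jordanMap (e : α ≃ᵐ β) (j : JordanDecomposition α) :
    (jordanMap e j).toSignedMeasure = j.toSignedMeasure.map e := by
  ext A hA
  rw [VectorMeasure.map_apply _ e.measurable hA, JordanDecomposition.toSignedMeasure,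
    JordanDecomposition.toSignedMeasure, Measure.toSignedMeasure_sub_apply hA,
    Measure.toSignedMeasure_sub_apply (e.measurable hA)]
  simp only [jordanMap, map_measureReal_apply e.measurable hA]

theorem toJordanDecomposition_map (e : α ≃ᵐ β) (s : SignedMeasure α) :
    SignedMeasure.toJordanDecomposition (s.map e) = jordanMap e s.toJordanDecomposition := by
  refine SignedMeasure.toJordanDecomposition_eq ?_
  rw [toSignedMeasure_jordanMap, SignedMeasure.toSignedMeasure_toJordanDecomposition]

end JordanDecomposition

section CharFun

variable {V W : Type*} [NormedAddCommGroup V] [InnerProductSpace ℝ V] [MeasurableSpace V]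
  [BorelSpace V] [NormedAddCommGroup W] [InnerProductSpace ℝ W] [MeasurableSpace W] [BorelSpace W]

theorem charFun_map_linearIsometryEquiv (μ : Measure V) (f : V ≃ₗᵢ[ℝ] W) (t : W) :
    charFun (μ.map f) t = charFun μ (f.symm t) := by
  rw [charFun_apply, charFun_apply, integral_map (by fun_prop) (by fun_prop)]
  simp only [LinearIsometryEquiv.inner_map_eq_flip]

theorem charFun_eq_of_norm_eq {μ : Measure V} (hμ : ∀ f : V ≃ₗᵢ[ℝ] V, μ.map f = μ) {s t : V}
    (h : ‖s‖ = ‖t‖) : charFun μ s = charFun μ t := by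
  rw [← Submodule.reflection_sub h, ← (ℝ ∙ (s - t))ᗮ.reflection_symm,
    ← charFun_map_linearIsometryEquiv, hμ]

theorem integral_charFun_norm_smul {μ ν : Measure V}
    (hμ : ∀ f : V ≃ₗᵢ[ℝ] V, μ.map f = μ) (hν : ∀ᵐ x ∂ν, ‖x‖ = 1) (t : V) :
    ∫ x, charFun μ (‖t‖ • x) ∂ν = ν.real Set.univ * charFun μ t := by
  have hconst : (fun x => charFun μ (‖t‖ • x)) =ᵐ[ν] fun _ => charFun μ t := by
    filter_upwards [hν] with x hx
    exact charFun_eq_of_norm_eq hμ (by rw [norm_smul, norm_norm, hx, mul_one])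
  rw [integral_congr_ae hconst, integral_const, Complex.real_smul]

theorem restrict_sphere_map {μ : Measure V} (f : V ≃ₗᵢ[ℝ] V) (hf : μ.map f = μ) :
    (μ.restrict (Metric.sphere 0 1)).map f = μ.restrict (Metric.sphere 0 1) := by
  conv_rhs => rw [← hf]
  rw [Measure.restrict_map (by fun_prop) Metric.isClosed_sphere.measurableSet,
    LinearIsometryEquiv.preimage_sphere, map_zero]

variable [SecondCountableTopology V]

theorem integral_charFun_smul_comm (μ ν : Measure V) [IsFiniteMeasure μ] [IsFiniteMeasure ν]
    (r : ℝ) : ∫ x, charFun μ (r • x) ∂ν = ∫ x, charFun ν (r • x) ∂μ := by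
  simp only [charFun_apply]
  rw [integral_integral_swap]
  · simp only [inner_smul_right, real_inner_comm]
  · refine Integrable.of_bound (C := 1) ?_ (.of_forall fun x => ?_)
    · refine Continuous.aestronglyMeasurable ?_
      unfold Function.uncurry
      fun_prop
    · exact (Complex.norm_exp_ofReal_mul_I _).le

theorem smul_eq_smul_of_invariant [CompleteSpace V] {μ ν : Measure V} [IsFiniteMeasure μ]
    [IsFiniteMeasure ν] (hμ : ∀ f : V ≃ₗᵢ[ℝ] V, μ.map f = μ) (hν : ∀ f : V ≃ₗᵢ[ℝ] V, ν.map f = ν)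
    (hμ' : ∀ᵐ x ∂μ, ‖x‖ = 1) (hν' : ∀ᵐ x ∂ν, ‖x‖ = 1) :
    ν Set.univ • μ = μ Set.univ • ν := by
  have := μ.smul_finite (measure_ne_top ν Set.univ)
  have := ν.smul_finite (measure_ne_top μ Set.univ)
  refine Measure.ext_of_charFun (funext fun t => ?_)
  have h := integral_charFun_smul_comm μ ν ‖t‖
  rw [integral_charFun_norm_smul hμ hν', integral_charFun_norm_smul hν hμ'] at h
  simpa only [charFun_apply, integral_smul_measure, Complex.real_smul, ← measureReal_def] using h

end CharFun

theorem normalize_map {V W : Type*} [NormedAddCommGroup V] [NormedSpace ℝ V]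
    [NormedAddCommGroup W] [NormedSpace ℝ W] (f : V →ₗᵢ[ℝ] W) (x : V) :
    NormedSpace.normalize (f x) = f (NormedSpace.normalize x) := by
  simp [NormedSpace.normalize]

section SphericalGaussian

variable {V : Type*} [NormedAddCommGroup V] [InnerProductSpace ℝ V] [FiniteDimensional ℝ V]
  [MeasurableSpace V] [BorelSpace V]

theorem stdGaussian_submodule_eq_zero {W : Submodule ℝ V} (hW : W ≠ ⊤) :
    stdGaussian V W = 0 := by
  obtain ⟨l, hl0, hl⟩ := W.exists_le_ker_of_lt_top hW.lt_top
  let φ : StrongDual ℝ V := l.toContinuousLinearMap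
  have hφ : ‖φ‖ ≠ 0 := norm_ne_zero_iff.2 fun h => hl0 (LinearMap.toContinuousLinearMap.injective
    (h.trans (map_zero _).symm))
  have hmap : (stdGaussian V).map φ = gaussianReal 0 (‖φ‖ ^ 2).toNNReal := by
    rw [IsGaussian.map_eq_gaussianReal, variance_dual_stdGaussian, integral_strongDual_stdGaussian]
  have := nullSingletonClass_gaussianReal (μ := 0) (v := (‖φ‖ ^ 2).toNNReal) (by simpa using hφ)
  refine measure_mono_null (t := φ ⁻¹' {0}) hl ?_
  rw [← Measure.map_apply (by fun_prop) (measurableSet_singleton 0), hmap, measure_singleton]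

theorem measurable_normalize : Measurable (NormedSpace.normalize : V → V) := by
  unfold NormedSpace.normalize
  fun_prop

/-- The standard Gaussian measure, projected radially to the unit sphere. -/
def sphericalGaussian (V : Type*) [NormedAddCommGroup V] [InnerProductSpace ℝ V]
    [FiniteDimensional ℝ V] [MeasurableSpace V] : Measure V :=
  (stdGaussian V).map NormedSpace.normalize

instance : IsProbabilityMeasure (sphericalGaussian V) :=
  Measure.isProbabilityMeasure_map measurable_normalize.aemeasurable

theorem sphericalGaussian_map (f : V ≃ₗᵢ[ℝ] V) :
    (sphericalGaussian V).map f = sphericalGaussian V := by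
  have hcomm : (f : V → V) ∘ NormedSpace.normalize = NormedSpace.normalize ∘ f :=
    funext fun x => (normalize_map f.toLinearIsometry x).symm
  rw [sphericalGaussian, Measure.map_map (by fun_prop) measurable_normalize, hcomm,
    ← Measure.map_map measurable_normalize (by fun_prop), stdGaussian_map]

theorem norm_eq_one_ae_sphericalGaussian [Nontrivial V] :
    ∀ᵐ x ∂(sphericalGaussian V), ‖x‖ = 1 := by
  rw [sphericalGaussian, ae_map_iff measurable_normalize.aemeasurable
    (measurableSet_eq_fun (by fun_prop) (by fun_prop))]
  have hne : ∀ᵐ x ∂(stdGaussian V), x ≠ 0 := by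
    refine measure_mono_null (fun x hx => ?_) (stdGaussian_submodule_eq_zero (V := V) bot_ne_top)
    simpa using hx
  filter_upwards [hne] with x hx
  exact NormedSpace.norm_normalize_eq_one_iff.2 hx

theorem measureReal_inter_sphere_of_invariant [Nontrivial V] {μ : Measure V} [IsFiniteMeasure μ]
    (hμ : ∀ f : V ≃ₗᵢ[ℝ] V, μ.map f = μ) {A : Set V} (hA : MeasurableSet A) :
    μ.real (A ∩ Metric.sphere 0 1) =
      μ.real (Metric.sphere 0 1) * (sphericalGaussian V).real A := by
  have hae : ∀ᵐ x ∂(μ.restrict (Metric.sphere 0 1)), ‖x‖ = 1 := by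
    filter_upwards [ae_restrict_mem Metric.isClosed_sphere.measurableSet] with x hx
    exact mem_sphere_zero_iff_norm.1 hx
  have h := smul_eq_smul_of_invariant (fun f => restrict_sphere_map f (hμ f))
    sphericalGaussian_map hae norm_eq_one_ae_sphericalGaussian
  have hA' := congrArg (fun ν : Measure V => ν.real A) h
  simpa [measureReal_restrict_apply hA, ← measureReal_def] using hA'

theorem signedMeasure_inter_sphere_of_invariant [Nontrivial V] {s : SignedMeasure V}
    (hs : ∀ f : V ≃ₗᵢ[ℝ] V, s.map f = s) {A : Set V} (hA : MeasurableSet A) :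
    s (A ∩ Metric.sphere 0 1) = s (Metric.sphere 0 1) * (sphericalGaussian V).real A := by
  have hS : MeasurableSet (Metric.sphere (0 : V) 1) := Metric.isClosed_sphere.measurableSet
  have hj (f : V ≃ₗᵢ[ℝ] V) : jordanMap f.toHomeomorph.toMeasurableEquiv s.toJordanDecomposition =
      s.toJordanDecomposition := by
    rw [← toJordanDecomposition_map]
    exact congrArg _ (hs f)
  have hpos := measureReal_inter_sphere_of_invariant
    (fun f => congrArg JordanDecomposition.posPart (hj f)) hA
  have hneg := measureReal_inter_sphere_of_invariant
    (fun f => congrArg JordanDecomposition.negPart (hj f)) hA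
  rw [s.apply_eq_posPart_real_sub_negPart_real (hA.inter hS),
    s.apply_eq_posPart_real_sub_negPart_real hS, hpos, hneg, sub_mul]

end SphericalGaussian

/-! ### Faces of polyhedral cones -/

section Isometry

variable {𝕜 V : Type*} [RCLike 𝕜] [NormedAddCommGroup V] [InnerProductSpace 𝕜 V]
  {L L' : Submodule 𝕜 V}

theorem map_eq_of_extend {f : L ≃ₗᵢ[𝕜] L'} {Q : V ≃ₗᵢ[𝕜] V} (hQ : ∀ x : L, Q x = f x) :
    L.map (Q.toLinearEquiv : V →ₗ[𝕜] V) = L' := by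
  ext y
  rw [Submodule.mem_map]
  constructor
  · rintro ⟨x, hx, rfl⟩
    exact (hQ ⟨x, hx⟩).symm ▸ (f ⟨x, hx⟩).2
  · intro hy
    exact ⟨f.symm ⟨y, hy⟩, Subtype.coe_prop _, (hQ _).trans (by rw [f.apply_symm_apply])⟩

variable [FiniteDimensional 𝕜 V]

theorem exists_linearIsometryEquiv_extend (f : L ≃ₗᵢ[𝕜] L') :
    ∃ Q : V ≃ₗᵢ[𝕜] V, ∀ x : L, Q x = f x := by
  let g : L →ₗᵢ[𝕜] V := L'.subtypeₗᵢ.comp f.toLinearIsometry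
  exact ⟨g.extend.toLinearIsometryEquiv rfl, g.extend_apply⟩

theorem exists_linearIsometryEquiv_map_eq (h : Module.finrank 𝕜 L = Module.finrank 𝕜 L') :
    ∃ Q : V ≃ₗᵢ[𝕜] V, L.map (Q.toLinearEquiv : V →ₗ[𝕜] V) = L' := by
  let f : L ≃ₗᵢ[𝕜] L' := (stdOrthonormalBasis 𝕜 L).equiv (stdOrthonormalBasis 𝕜 L') (finCongr h)
  obtain ⟨Q, hQ⟩ := exists_linearIsometryEquiv_extend f
  exact ⟨Q, map_eq_of_extend hQ⟩

end Isometry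

theorem exists_submodule_finrank_eq {K V : Type*} [DivisionRing K] [AddCommGroup V] [Module K V]
    {k : ℕ} (hk : k ≤ Module.finrank K V) : ∃ L : Submodule K V, Module.finrank K L = k := by
  obtain ⟨v, hv⟩ := exists_linearIndependent_of_le_finrank hk
  exact ⟨_, (finrank_span_eq_card hv).trans (Fintype.card_fin k)⟩

namespace PolyhedralCone

variable {d k : ℕ} {A : Set (E d)} {C : PolyhedralCone d} {L L' : Submodule ℝ (E d)} {x v : E d}

theorem mem_relInterior_iff : x ∈ relInterior L A ↔ x ∈ L ∧ A ∈ nhdsWithin x L := by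
  constructor
  · rintro ⟨y, hy, rfl⟩
    exact ⟨y.2, preimage_coe_mem_nhds_subtype.1 (mem_interior_iff_mem_nhds.1 hy)⟩
  · rintro ⟨hx, hA⟩
    exact ⟨⟨x, hx⟩, mem_interior_iff_mem_nhds.2 (preimage_coe_mem_nhds_subtype.2 hA), rfl⟩

theorem relInterior_subset : relInterior L A ⊆ A ∩ L := by
  rintro _ ⟨x, hx, rfl⟩
  exact ⟨(interior_subset hx : x ∈ ((↑) : L → E d) ⁻¹' A), x.2⟩

theorem relInterior_eq_of_subset (h : (L : Set (E d)) ⊆ A) : relInterior L A = L := by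
  ext x
  exact ⟨fun hx => (relInterior_subset hx).2, fun hx =>
    mem_relInterior_iff.2 ⟨hx, Filter.mem_of_superset self_mem_nhdsWithin h⟩⟩

theorem measurableSet_relInterior (L : Submodule ℝ (E d)) (A : Set (E d)) :
    MeasurableSet (relInterior L A) := by
  have hL : MeasurableSet (L : Set (E d)) := L.closed_of_finiteDimensional.measurableSet
  exact (MeasurableEmbedding.subtype_coe hL).measurableSet_image.2 isOpen_interior.measurableSet

theorem smul_mem_relInterior (hA : ∀ r : ℝ, 0 < r → ∀ y ∈ A, r • y ∈ A) {r : ℝ} (hr : 0 < r)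
    (hx : x ∈ relInterior L A) : r • x ∈ relInterior L A := by
  rw [mem_relInterior_iff] at hx ⊢
  refine ⟨L.smul_mem r hx.1, ?_⟩
  have hcont : Filter.Tendsto (fun y : E d => r⁻¹ • y) (nhdsWithin (r • x) L) (nhdsWithin x L) := by
    refine tendsto_nhdsWithin_iff.2 ⟨?_, ?_⟩
    · exact ((continuous_const_smul r⁻¹).tendsto' _ _ (inv_smul_smul₀ hr.ne' x)).mono_left
        nhdsWithin_le_nhds
    · filter_upwards [self_mem_nhdsWithin] with y hy using L.smul_mem _ hy
  filter_upwards [hcont hx.2] with y hy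
  simpa only [smul_inv_smul₀ hr.ne'] using hA r hr _ hy

theorem eventually_add_smul_mem_of_mem_relInterior (hx : x ∈ relInterior L A) (hv : v ∈ L) :
    ∀ᶠ ε : ℝ in nhds 0, x + ε • v ∈ A := by
  obtain ⟨hxL, hA⟩ := mem_relInterior_iff.1 hx
  have hline : Filter.Tendsto (fun ε : ℝ => x + ε • v) (nhds 0) (nhdsWithin x L) := by
    refine tendsto_nhdsWithin_iff.2 ⟨?_, .of_forall fun ε => L.add_mem hxL (L.smul_mem ε hv)⟩
    exact Continuous.tendsto' (by fun_prop) _ _ (by simp)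
  exact hline hA

theorem exists_pos_segment_of_mem_relInterior (hx : x ∈ relInterior L A) (hv : v ∈ L) :
    ∃ ε : ℝ, 0 < ε ∧ x + ε • v ∈ A ∧ x - ε • v ∈ A := by
  have hpos := eventually_add_smul_mem_of_mem_relInterior hx hv
  have hneg := eventually_add_smul_mem_of_mem_relInterior hx (L.neg_mem hv)
  obtain ⟨ε, hε, hε0⟩ := (((hpos.and hneg).filter_mono nhdsWithin_le_nhds).and
    (self_mem_nhdsWithin : Set.Ioi (0 : ℝ) ∈ nhdsWithin 0 (Set.Ioi 0))).exists
  exact ⟨ε, hε0, hε.1, by simpa only [smul_neg, ← sub_eq_add_neg] using hε.2⟩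

theorem smul_mem_carrier_iff (C : PolyhedralCone d) {r : ℝ} (hr : 0 < r) :
    r • x ∈ C.carrier ↔ x ∈ C.carrier := by
  refine ⟨fun h => ?_, C.1.smul_mem hr.le⟩
  have hinv := C.1.smul_mem (inv_nonneg.2 hr.le) h
  rwa [inv_smul_smul₀ hr.ne'] at hinv

theorem span_face_le_orthogonal (B : Set (E d)) (z : E d) :
    Submodule.span ℝ {y ∈ B | inner ℝ y z = 0} ≤ (ℝ ∙ z)ᗮ :=
  Submodule.span_le.2 fun _ hy => Submodule.mem_orthogonal_singleton_iff_inner_left.2 hy.2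

theorem mem_of_mem_faceSpans_of_segment (hL : L ∈ C.faceSpans k) (hx : x ∈ L) {ε : ℝ} (hε : 0 < ε)
    (hadd : x + ε • v ∈ C.carrier) (hsub : x - ε • v ∈ C.carrier) : v ∈ L := by
  obtain ⟨⟨F, ⟨z, hz, rfl⟩, rfl⟩, -⟩ := hL
  have hxz : inner ℝ x z = 0 :=
    Submodule.mem_orthogonal_singleton_iff_inner_left.1 (span_face_le_orthogonal _ z hx)
  have haddz := hz _ hadd
  have hsubz := hz _ hsub
  rw [inner_add_left, real_inner_smul_left, hxz, zero_add] at haddz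
  rw [inner_sub_left, real_inner_smul_left, hxz, zero_sub, neg_nonpos] at hsubz
  have hface : x + ε • v ∈ Submodule.span ℝ {y ∈ C.carrier | inner ℝ y z = 0} := by
    refine Submodule.subset_span ⟨hadd, ?_⟩
    rw [inner_add_left, real_inner_smul_left, hxz, zero_add]
    exact le_antisymm haddz hsubz
  rwa [Submodule.add_mem_iff_right _ hx, Submodule.smul_mem_iff _ hε.ne'] at hface

theorem mem_faceSpan_iff (hL : L ∈ C.faceSpans k) (hx : x ∈ relInterior L C.carrier) :
    v ∈ L ↔ ∃ ε : ℝ, 0 < ε ∧ x + ε • v ∈ C.carrier ∧ x - ε • v ∈ C.carrier :=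
  ⟨exists_pos_segment_of_mem_relInterior hx, fun ⟨_, hε, hadd, hsub⟩ =>
    mem_of_mem_faceSpans_of_segment hL (relInterior_subset hx).2 hε hadd hsub⟩

theorem faceSpans_eq_of_mem_relInterior {j : ℕ} (hL : L ∈ C.faceSpans k) (hL' : L' ∈ C.faceSpans j)
    (hx : x ∈ relInterior L C.carrier) (hx' : x ∈ relInterior L' C.carrier) : L = L' := by
  ext v
  rw [mem_faceSpan_iff hL hx, mem_faceSpan_iff hL' hx']

theorem mem_relInterior_of_active_le {s : Finset (E d)}
    (hs : ∀ y, y ∈ C.carrier ↔ ∀ a ∈ s, 0 ≤ inner ℝ a y) (hxC : x ∈ C.carrier) (hxL : x ∈ L)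
    (hactive : ∀ a ∈ s, inner ℝ a x = 0 → L ≤ (ℝ ∙ a)ᗮ) : x ∈ relInterior L C.carrier := by
  refine mem_relInterior_iff.2 ⟨hxL, ?_⟩
  have hnear : ∀ᶠ y in nhdsWithin x L, ∀ a ∈ s, 0 ≤ inner ℝ a y := by
    refine (Filter.eventually_all_finset s).2 fun a ha => ?_
    rcases ((hs x).1 hxC a ha).eq_or_lt with hzero | hpos
    · filter_upwards [self_mem_nhdsWithin] with y hy
      exact (Submodule.mem_orthogonal_singleton_iff_inner_right.1 (hactive a ha hzero.symm hy)).ge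
    · have hcont : Continuous fun y : E d => (inner ℝ a y : ℝ) := by fun_prop
      exact ((hcont.continuousAt.eventually (lt_mem_nhds hpos)).filter_mono
        nhdsWithin_le_nhds).mono fun _ => le_of_lt
  filter_upwards [hnear] with y hy using (hs y).2 hy

theorem exists_isFace_active {s : Finset (E d)}
    (hs : ∀ y, y ∈ C.carrier ↔ ∀ a ∈ s, 0 ≤ inner ℝ a y) (hx : x ∈ C.carrier) :
    ∃ F, C.IsFace F ∧ x ∈ F ∧
      ∀ a ∈ s, inner ℝ a x = 0 → Submodule.span ℝ F ≤ (ℝ ∙ a)ᗮ := by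
  classical
  -- The sum of the active constraints is nonnegative on `C` and vanishes only where they all do.
  let z := ∑ a ∈ s with inner ℝ a x = 0, a
  have hterm (y : E d) (hy : y ∈ C.carrier) :
      ∀ a ∈ s.filter fun a => inner ℝ a x = 0, 0 ≤ (inner ℝ a y : ℝ) :=
    fun a ha => (hs y).1 hy a (Finset.mem_filter.1 ha).1
  have hz (y : E d) : inner ℝ y (-z) = -∑ a ∈ s with inner ℝ a x = 0, (inner ℝ a y : ℝ) := by
    rw [inner_neg_right, real_inner_comm, sum_inner]
  refine ⟨_, ⟨-z, fun y hy => ?_, rfl⟩, ⟨hx, ?_⟩, fun a ha hax => Submodule.span_le.2 ?_⟩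
  · rw [hz, neg_nonpos]
    exact Finset.sum_nonneg (hterm y hy)
  · rw [hz, neg_eq_zero]
    exact Finset.sum_eq_zero fun a ha => (Finset.mem_filter.1 ha).2
  · rintro y ⟨hyC, hy⟩
    rw [hz, neg_eq_zero, Finset.sum_eq_zero_iff_of_nonneg (hterm y hyC)] at hy
    exact Submodule.mem_orthogonal_singleton_iff_inner_right.2
      (hy a (Finset.mem_filter.2 ⟨ha, hax⟩))

theorem exists_mem_relInterior (hx : x ∈ C.carrier) :
    ∃ k, ∃ L ∈ C.faceSpans k, x ∈ relInterior L C.carrier := by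
  obtain ⟨s, hs⟩ := C.exists_halfspaces
  obtain ⟨F, hF, hxF, hactive⟩ := exists_isFace_active hs hx
  exact ⟨_, _, ⟨⟨F, hF, rfl⟩, rfl⟩,
    mem_relInterior_of_active_le hs hx (Submodule.subset_span hxF) hactive⟩

theorem exists_finset_subset_relInterior_union (C : PolyhedralCone d) (L : Submodule ℝ (E d)) :
    ∃ t : Finset (E d), (∀ a ∈ t, ¬ L ≤ (ℝ ∙ a)ᗮ) ∧
      C.carrier ∩ L ⊆ relInterior L C.carrier ∪ ⋃ a ∈ t, ((ℝ ∙ a)ᗮ : Submodule ℝ (E d)) := by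
  classical
  obtain ⟨s, hs⟩ := C.exists_halfspaces
  refine ⟨{a ∈ s | ¬ L ≤ (ℝ ∙ a)ᗮ}, fun a ha => (Finset.mem_filter.1 ha).2, ?_⟩
  rintro x ⟨hxC, hxL⟩
  by_contra! hx
  simp only [Set.mem_union, Set.mem_iUnion, not_or, not_exists] at hx
  refine hx.1 (mem_relInterior_of_active_le hs hxC hxL fun a ha hax => ?_)
  by_contra haL
  exact hx.2 a (Finset.mem_filter.2 ⟨ha, haL⟩)
    (Submodule.mem_orthogonal_singleton_iff_inner_right.2 hax)

theorem le_of_mem_faceSpans (hL : L ∈ C.faceSpans k) : k ≤ d := by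
  simpa [hL.2] using Submodule.finrank_le L

theorem ne_bot_of_mem_faceSpans (hL : L ∈ C.faceSpans k) (hk : 1 ≤ k) : L ≠ ⊥ :=
  fun h => (Nat.one_le_iff_ne_zero.1 hk) (hL.2.symm.trans (Submodule.finrank_eq_zero.2 h))

theorem skeleton_inter_of_subset_relInterior (hL : L ∈ C.faceSpans k)
    (hA : A ⊆ relInterior L C.carrier) (j : ℕ) : C.skeleton j ∩ A = {x ∈ A | j = k} := by
  ext x
  simp only [skeleton, Set.mem_inter_iff, Set.mem_iUnion, exists_prop, Set.mem_ofPred_eq]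
  constructor
  · rintro ⟨⟨L', hL', hx'⟩, hx⟩
    refine ⟨hx, ?_⟩
    rw [← hL.2, ← hL'.2, faceSpans_eq_of_mem_relInterior hL hL' (hA hx) hx']
  · rintro ⟨hx, rfl⟩
    exact ⟨⟨L, hL, hA hx⟩, hx⟩

theorem eq_lineal_of_zero_mem_relInterior (hL : L ∈ C.faceSpans k)
    (h0 : 0 ∈ relInterior L C.carrier) : L = C.1.lineal := by
  ext v
  rw [mem_faceSpan_iff hL h0, PointedCone.mem_lineal]
  constructor
  · rintro ⟨ε, hε, hpos, hneg⟩
    rw [zero_add, smul_mem_carrier_iff C hε] at hpos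
    rw [zero_sub, ← smul_neg, smul_mem_carrier_iff C hε] at hneg
    exact ⟨hpos, hneg⟩
  · rintro ⟨hpos, hneg⟩
    exact ⟨1, one_pos, by rwa [zero_add, one_smul], by rwa [zero_sub, one_smul]⟩

theorem lineal_mem_faceSpans (C : PolyhedralCone d) : C.1.lineal ∈ C.faceSpans C.lin := by
  obtain ⟨k, L, hL, h0⟩ := exists_mem_relInterior (C := C) C.1.zero_mem
  rw [← eq_lineal_of_zero_mem_relInterior hL h0]
  exact ⟨hL.1, by rw [lin, eq_lineal_of_zero_mem_relInterior hL h0]⟩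

theorem zero_mem_relInterior_lineal (C : PolyhedralCone d) :
    0 ∈ relInterior C.1.lineal C.carrier := by
  have hsub : (C.1.lineal : Set (E d)) ⊆ C.carrier := fun x hx => (PointedCone.mem_lineal.1 hx).1
  rw [relInterior_eq_of_subset hsub]
  exact C.1.lineal.zero_mem

theorem mem_faceSpans_zero_iff : L ∈ C.faceSpans 0 ↔ L = ⊥ ∧ C.lin = 0 := by
  constructor
  · intro hL
    obtain rfl : L = ⊥ := Submodule.finrank_eq_zero.1 hL.2
    have hsub : ((⊥ : Submodule ℝ (E d)) : Set (E d)) ⊆ C.carrier :=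
      Set.singleton_subset_iff.2 C.1.zero_mem
    have h0 : 0 ∈ relInterior ⊥ C.carrier := by
      rw [relInterior_eq_of_subset hsub]
      exact Submodule.zero_mem ⊥
    rw [lin, ← eq_lineal_of_zero_mem_relInterior hL h0, finrank_bot]
    exact ⟨rfl, rfl⟩
  · rintro ⟨rfl, hlin⟩
    have hL := C.lineal_mem_faceSpans
    rwa [hlin, Submodule.finrank_eq_zero.1 hlin] at hL

theorem carrier_ofSubspace (L : Submodule ℝ (E d)) : (ofSubspace L).carrier = L := rfl

theorem mem_faceSpans_ofSubspace (L : Submodule ℝ (E d)) :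
    L ∈ (ofSubspace L).faceSpans (Module.finrank ℝ L) :=
  ⟨⟨L, ⟨0, by simp, by simp [carrier_ofSubspace]⟩, by simp⟩, rfl⟩

theorem relInterior_ofSubspace (L : Submodule ℝ (E d)) :
    relInterior L (ofSubspace L).carrier = L :=
  relInterior_eq_of_subset subset_rfl

theorem rotate_ofSubspace (Q : E d ≃ₗᵢ[ℝ] E d) (L : Submodule ℝ (E d)) :
    (ofSubspace L).rotate Q = ofSubspace (L.map (Q.toLinearEquiv : E d →ₗ[ℝ] E d)) := by
  refine Subtype.ext ?_
  ext x
  simp only [rotate, ofSubspace, PointedCone.mem_map, PointedCone.mem_ofSubmodule_iff,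
    Submodule.mem_map]

end PolyhedralCone

/-! ### Gaussian measures on subspaces -/

section Gaussian

variable {d : ℕ} {L W : Submodule ℝ (E d)}

theorem gaussianOn_submodule_eq_zero (h : ¬ L ≤ W) : gaussianOn L W = 0 := by
  rw [gaussianOn, Measure.map_apply measurable_subtype_coe
    W.closed_of_finiteDimensional.measurableSet]
  exact stdGaussian_submodule_eq_zero (W := W.comap L.subtype)
    (mt Submodule.comap_subtype_eq_top.1 h)

theorem gaussianOn_bot : gaussianOn (⊥ : Submodule ℝ (E d)) = Measure.dirac 0 := by
  have hconst : ((↑) : (⊥ : Submodule ℝ (E d)) → E d) = fun _ => 0 :=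
    funext fun x => (Submodule.mem_bot ℝ).1 x.2
  rw [gaussianOn, hconst, Measure.map_const, measure_univ, one_smul]

theorem inter_ae_eq_relInterior (C : PolyhedralCone d) (L : Submodule ℝ (E d)) :
    (C.carrier ∩ L : Set (E d)) =ᵐ[gaussianOn L] PolyhedralCone.relInterior L C.carrier := by
  obtain ⟨t, ht, hsub⟩ := PolyhedralCone.exists_finset_subset_relInterior_union C L
  refine ae_eq_set.2 ⟨?_, ?_⟩
  · refine measure_mono_null (Set.sdiff_subset_iff.2 hsub) ?_
    exact (measure_biUnion_null_iff t.countable_toSet).2 fun a ha =>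
      gaussianOn_submodule_eq_zero (ht a ha)
  · rw [Set.sdiff_eq_empty.2 PolyhedralCone.relInterior_subset, measure_empty]

theorem linMeasure_zero_eq_polyMeasure_zero :
    linMeasure (d := d) 0 = polyMeasure 0 := by
  funext C M
  by_cases hlin : C.lin = 0
  · have hfaces : (C.finite_faceSpans 0).toFinset = {⊥} := by
      ext L
      simp [PolyhedralCone.mem_faceSpans_zero_iff, hlin]
    have hinter : C.carrier ∩ (⊥ : Submodule ℝ (E d)) ∩ M.1 = {0} ∩ M.1 := by
      congr 1
      exact Set.inter_eq_right.2 (Set.singleton_subset_iff.2 C.1.zero_mem)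
    have hdirac (A : Set (E d)) :
        (Measure.dirac (0 : E d)).real ({0} ∩ A) = (Measure.dirac (0 : E d)).real A := by
      by_cases h0 : (0 : E d) ∈ A <;> simp [measureReal_def, h0]
    rw [linMeasure, if_pos hlin, one_mul, polyMeasure, hfaces, Finset.sum_singleton, hinter,
      gaussianOn_bot, hdirac]
  · have hfaces : (C.finite_faceSpans 0).toFinset = ∅ := by
      ext L
      simp [PolyhedralCone.mem_faceSpans_zero_iff, hlin]
    rw [linMeasure, if_neg hlin, zero_mul, polyMeasure, hfaces, Finset.sum_empty]

end Gaussian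

/-! ### Conic measures concentrated on a subspace -/

namespace ConicSet

variable {d : ℕ}

theorem smul_mem (M : ConicSet d) {r : ℝ} (hr : 0 < r) {x : E d} (hx : x ∈ M.1) : r • x ∈ M.1 :=
  (M.2.2 r hr).subset (Set.smul_mem_smul_set hx)

theorem normalize_mem_iff (M : ConicSet d) {x : E d} :
    NormedSpace.normalize x ∈ M.1 ↔ x ∈ M.1 := by
  rcases eq_or_ne x 0 with rfl | hx
  · rw [NormedSpace.normalize_zero_eq_zero]
  · refine ⟨fun h => ?_, M.smul_mem (inv_pos.2 (norm_pos_iff.2 hx))⟩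
    rw [← NormedSpace.norm_smul_normalize x]
    exact M.smul_mem (norm_pos_iff.2 hx) h

/-- The conic set with underlying set `A`, for a Borel set `A` stable under positive dilations. -/
def ofSMulMem (A : Set (E d)) (hA : MeasurableSet A)
    (hsmul : ∀ r : ℝ, 0 < r → ∀ x ∈ A, r • x ∈ A) : ConicSet d :=
  ⟨A, hA, fun r hr => by
    refine (Set.smul_set_subset_iff.2 fun x hx => hsmul r hr x hx).antisymm fun x hx => ?_
    exact (Set.mem_smul_set_iff_inv_smul_mem₀ hr.ne' A x).2 (hsmul _ (inv_pos.2 hr) x hx)⟩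

/-- The conic set `M ∩ N`. -/
def inter (M N : ConicSet d) : ConicSet d :=
  ⟨M.1 ∩ N.1, MeasurableSet.inter M.2 N.2⟩

/-- The relative interior of `C ∩ L` in `L` as a conic set. If `L` is the span of a face of `C`,
this is the relative interior of that face. -/
def relInterior (L : Submodule ℝ (E d)) (C : PolyhedralCone d) : ConicSet d :=
  ofSMulMem (PolyhedralCone.relInterior L C.carrier)
    (PolyhedralCone.measurableSet_relInterior L C.carrier) fun _ hr _ hx =>
      PolyhedralCone.smul_mem_relInterior (fun _ hs _ hy => C.1.smul_mem hs.le hy) hr hx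

theorem rotate_origin (Q : E d ≃ₗᵢ[ℝ] E d) : (origin d).rotate Q = origin d :=
  Subtype.ext (by simp [rotate, origin])

theorem rotate_punctured (Q : E d ≃ₗᵢ[ℝ] E d) : (punctured d).rotate Q = punctured d :=
  Subtype.ext (by simp [rotate, punctured, Set.image_compl_eq Q.bijective])

end ConicSet

section RadialProjection

variable {d : ℕ} {L : Submodule ℝ (E d)}

/-- The orthogonal projection onto `L` followed by the radial projection onto the unit sphere.
It maps `0` to `0`, since `NormedSpace.normalize 0 = 0`. -/
def radialProjection (L : Submodule ℝ (E d)) (x : E d) : L :=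
  NormedSpace.normalize (L.orthogonalProjectionOnto x)

theorem radialProjection_smul {r : ℝ} (hr : 0 < r) (x : E d) :
    radialProjection L (r • x) = radialProjection L x := by
  rw [radialProjection, map_smul, NormedSpace.normalize_smul_of_pos hr, radialProjection]

theorem coe_radialProjection {x : E d} (hx : x ∈ L) :
    (radialProjection L x : E d) = NormedSpace.normalize x := by
  rw [radialProjection, L.orthogonalProjectionOnto_mem_subspace_eq_self ⟨x, hx⟩]
  exact (normalize_map L.subtypeₗᵢ ⟨x, hx⟩).symm

theorem radialProjection_extend {f : L ≃ₗᵢ[ℝ] L} {Q : E d ≃ₗᵢ[ℝ] E d}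
    (hQ : ∀ x : L, Q x = f x) {x : E d} (hx : x ∈ L) :
    radialProjection L (Q x) = f (radialProjection L x) := by
  have hQx : Q x ∈ L := hQ ⟨x, hx⟩ ▸ (f ⟨x, hx⟩).2
  refine Subtype.ext ?_
  rw [coe_radialProjection hQx, ← hQ, coe_radialProjection hx]
  exact normalize_map Q.toLinearIsometry x

theorem radialProjection_mem_sphere_iff {x : E d} (hx : x ∈ L) :
    radialProjection L x ∈ Metric.sphere 0 1 ↔ x ≠ 0 := by
  rw [mem_sphere_zero_iff_norm, ← Submodule.norm_coe, coe_radialProjection hx,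
    NormedSpace.norm_normalize_eq_one_iff]

theorem measurable_radialProjection (L : Submodule ℝ (E d)) : Measurable (radialProjection L) :=
  measurable_normalize.comp L.orthogonalProjectionOnto.continuous.measurable

/-- The conic set of the points whose radial projection to the unit sphere of `L` lies in `A`. -/
def radialPreimage (L : Submodule ℝ (E d)) {A : Set L} (hA : MeasurableSet A) : ConicSet d :=
  .ofSMulMem (radialProjection L ⁻¹' A) (measurable_radialProjection L hA) fun r hr x hx => by
    rwa [Set.mem_preimage, radialProjection_smul hr]

theorem rotate_radialPreimage {f : L ≃ₗᵢ[ℝ] L} {Q : E d ≃ₗᵢ[ℝ] E d} (hQ : ∀ x : L, Q x = f x)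
    {A : Set L} (hA : MeasurableSet A) (hfA : MeasurableSet (f ⁻¹' A)) :
    ((radialPreimage L hfA).interCone (.ofSubspace L)).rotate Q =
      (radialPreimage L hA).interCone (.ofSubspace L) := by
  refine Subtype.ext (Set.ext fun y => ?_)
  change y ∈ Q '' (radialProjection L ⁻¹' (f ⁻¹' A) ∩ L) ↔ y ∈ radialProjection L ⁻¹' A ∩ L
  constructor
  · rintro ⟨x, ⟨hxA, hxL⟩, rfl⟩
    refine ⟨?_, hQ ⟨x, hxL⟩ ▸ (f ⟨x, hxL⟩).2⟩
    rwa [Set.mem_preimage, radialProjection_extend hQ hxL]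
  · rintro ⟨hyA, hyL⟩
    have hQy : Q (f.symm ⟨y, hyL⟩) = y := by rw [hQ, f.apply_symm_apply]
    refine ⟨f.symm ⟨y, hyL⟩, ⟨?_, Subtype.coe_prop _⟩, hQy⟩
    rwa [Set.mem_preimage, Set.mem_preimage, ← radialProjection_extend hQ (Subtype.coe_prop _), hQy]

theorem interCone_radialPreimage_inter_sphere (M : ConicSet d)
    (hA : MeasurableSet (((↑) : L → E d) ⁻¹' M.1 ∩ Metric.sphere 0 1)) :
    (radialPreimage L hA).interCone (.ofSubspace L) =
      (M.inter (.punctured d)).interCone (.ofSubspace L) := by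
  refine Subtype.ext (Set.ext fun x => and_congr_left fun hx => ?_)
  change (radialProjection L x : E d) ∈ M.1 ∧ radialProjection L x ∈ Metric.sphere 0 1 ↔
    x ∈ M.1 ∧ x ≠ 0
  rw [coe_radialProjection hx, M.normalize_mem_iff, radialProjection_mem_sphere_iff hx]

theorem sphericalGaussian_preimage_coe (M : ConicSet d) :
    (sphericalGaussian L).real ((↑) ⁻¹' M.1) = (gaussianOn L).real M.1 := by
  have hM : MeasurableSet (((↑) : L → E d) ⁻¹' M.1) := measurable_subtype_coe M.2.1
  rw [sphericalGaussian, gaussianOn, map_measureReal_apply measurable_normalize hM,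
    map_measureReal_apply measurable_subtype_coe M.2.1]
  congr 1
  ext x
  rw [Set.mem_preimage, Set.mem_preimage, Set.mem_preimage, ← M.normalize_mem_iff (x := (x : E d))]
  exact iff_of_eq (congrArg (· ∈ M.1) (normalize_map L.subtypeₗᵢ x).symm)

end RadialProjection

/-- `μ` is concentrated on the cone `C`. -/
def IsConcentratedOn {d : ℕ} (μ : ConicSet d → ℝ) (C : PolyhedralCone d) : Prop :=
  ∀ M, μ M = μ (M.interCone C)

namespace IsConicMeasure

variable {d : ℕ} {μ : ConicSet d → ℝ} {C : PolyhedralCone d} {L : Submodule ℝ (E d)}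

theorem apply_eq_sum (hμ : IsConicMeasure μ) {ι : Type*} {t : Finset ι} {N : ι → ConicSet d}
    {M : ConicSet d} (hdisj : (t : Set ι).PairwiseDisjoint fun i => (N i).1)
    (hM : M.1 = ⋃ i ∈ t, (N i).1) : μ M = ∑ i ∈ t, μ (N i) := by
  obtain ⟨m, hm⟩ := hμ
  simp only [hm, hM]
  exact VectorMeasure.of_biUnion_finset hdisj fun i _ => (N i).2

theorem apply_eq_zero (hμ : IsConicMeasure μ) {M : ConicSet d} (hM : M.1 = ∅) : μ M = 0 := by
  obtain ⟨m, hm⟩ := hμ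
  rw [hm, hM, VectorMeasure.empty]

theorem apply_inter_origin_add_inter_punctured (hμ : IsConicMeasure μ) (M : ConicSet d) :
    μ (M.inter (.origin d)) + μ (M.inter (.punctured d)) = μ M := by
  obtain ⟨m, hm⟩ := hμ
  have hdisj : Disjoint (M.inter (.origin d)).1 (M.inter (.punctured d)).1 :=
    disjoint_compl_right.mono Set.inter_subset_right Set.inter_subset_right
  rw [hm, hm, hm]
  exact (VectorMeasure.of_union hdisj (M.inter (.origin d)).2 (M.inter (.punctured d)).2).symm.trans
    (congrArg m (Set.inter_union_compl M.1 {0}))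

theorem apply_inter_origin (hμ : IsConicMeasure μ) (M : ConicSet d) :
    μ (M.inter (.origin d)) = μ (.origin d) * (Measure.dirac (0 : E d)).real M.1 := by
  rw [measureReal_def, Measure.dirac_apply]
  by_cases h0 : (0 : E d) ∈ M.1
  · have hM : M.inter (.origin d) = .origin d :=
      Subtype.ext (Set.inter_eq_right.2 (Set.singleton_subset_iff.2 h0))
    rw [hM, Set.indicator_of_mem h0, Pi.one_apply, ENNReal.toReal_one, mul_one]
  · rw [hμ.apply_eq_zero (Set.inter_singleton_eq_empty.2 h0), Set.indicator_of_notMem h0,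
      ENNReal.toReal_zero, mul_zero]

theorem exists_signedMeasure_radialPreimage (hμ : IsConicMeasure μ) (L : Submodule ℝ (E d)) :
    ∃ ν : SignedMeasure L, ∀ A (hA : MeasurableSet A), ν A = μ (radialPreimage L hA) := by
  obtain ⟨m, hm⟩ := hμ
  have hρ : @Measurable _ _ (conicBorel d) _ (radialProjection L) :=
    fun A hA => (radialPreimage L hA).2
  refine ⟨@VectorMeasure.map _ _ (conicBorel d) _ _ _ _ m (radialProjection L), fun A hA => ?_⟩
  rw [hm, VectorMeasure.map_apply _ hρ hA]
  rfl

theorem apply_inter_punctured_eq_mul_gaussianOn (hμ : IsConicMeasure μ) (hL : L ≠ ⊥)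
    (hconc : IsConcentratedOn μ (.ofSubspace L))
    (hinv : ∀ Q : E d ≃ₗᵢ[ℝ] E d, L.map (Q.toLinearEquiv : E d →ₗ[ℝ] E d) = L →
      ∀ M : ConicSet d, μ (M.rotate Q) = μ M) (M : ConicSet d) :
    μ (M.inter (.punctured d)) = μ (.punctured d) * (gaussianOn L).real M.1 := by
  obtain ⟨ν, hν⟩ := hμ.exists_signedMeasure_radialPreimage L
  have hS : MeasurableSet (Metric.sphere (0 : L) 1) := Metric.isClosed_sphere.measurableSet
  have hνinv (f : L ≃ₗᵢ[ℝ] L) : ν.map f = ν := by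
    obtain ⟨Q, hQ⟩ := exists_linearIsometryEquiv_extend f
    ext A hA
    have hf : Measurable f := f.continuous.measurable
    rw [VectorMeasure.map_apply _ hf hA, hν _ (hf hA), hν A hA, hconc, hconc (radialPreimage L hA),
      ← rotate_radialPreimage hQ hA (hf hA), hinv Q (map_eq_of_extend hQ)]
  have hcone (N : ConicSet d) :
      ν ((↑) ⁻¹' N.1 ∩ Metric.sphere 0 1) = μ (N.inter (.punctured d)) := by
    rw [hν _ ((measurable_subtype_coe N.2.1).inter hS), hconc,
      interCone_radialPreimage_inter_sphere, ← hconc]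
  have : Nontrivial L := Submodule.nontrivial_iff_ne_bot.2 hL
  have hsphere : ν (Metric.sphere 0 1) = μ (.punctured d) :=
    (congrArg ν (Set.univ_inter _)).symm.trans <|
      (hcone ⟨Set.univ, MeasurableSet.univ⟩).trans <| congrArg μ (Subtype.ext (Set.univ_inter _))
  rw [← hcone, signedMeasure_inter_sphere_of_invariant hνinv (measurable_subtype_coe M.2.1),
    hsphere, sphericalGaussian_preimage_coe]

theorem apply_inter_punctured_eq_sum (hμ : IsConicMeasure μ) (hC : IsConcentratedOn μ C)
    (M : ConicSet d) :
    μ (M.inter (.punctured d)) = ∑ k ∈ Finset.Icc 1 d, ∑ L ∈ (C.finite_faceSpans k).toFinset,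
      μ ((M.inter (.relInterior L C)).inter (.punctured d)) := by
  rw [Finset.sum_sigma', hC]
  refine hμ.apply_eq_sum ?_ ?_
  · rintro ⟨j, L⟩ hL ⟨k, L'⟩ hL' hne
    rw [Finset.mem_coe, Finset.mem_sigma, Set.Finite.mem_toFinset] at hL hL'
    refine Set.disjoint_left.2 fun x hx hx' => hne ?_
    obtain rfl : L = L' :=
      PolyhedralCone.faceSpans_eq_of_mem_relInterior hL.2 hL'.2 hx.1.2 hx'.1.2
    obtain rfl : j = k := hL.2.2.symm.trans hL'.2.2
    rfl
  · ext x
    simp only [Set.mem_iUnion, exists_prop, Finset.mem_sigma, Sigma.exists, Finset.mem_Icc,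
      Set.Finite.mem_toFinset]
    constructor
    · rintro ⟨⟨hxM, hx0⟩, hxC⟩
      obtain ⟨k, L, hL, hx⟩ := PolyhedralCone.exists_mem_relInterior hxC
      have hk : 1 ≤ k := Nat.one_le_iff_ne_zero.2 fun hk => hx0 <| by
        subst hk
        exact (Submodule.mem_bot ℝ).1 ((PolyhedralCone.mem_faceSpans_zero_iff.1 hL).1 ▸
          (PolyhedralCone.relInterior_subset hx).2)
      exact ⟨k, L, ⟨⟨hk, PolyhedralCone.le_of_mem_faceSpans hL⟩, hL⟩, ⟨hxM, hx⟩, hx0⟩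
    · rintro ⟨k, L, -, ⟨hxM, hx⟩, hx0⟩
      exact ⟨⟨hxM, hx0⟩, (PolyhedralCone.relInterior_subset hx).1⟩

end IsConicMeasure

/-! ### Characterization of polyhedral measures -/

section ConicFunctional

variable {d : ℕ} {ψ : PolyhedralCone d → ConicSet d → ℝ} {C : PolyhedralCone d}
  {L L' : Submodule ℝ (E d)} {M : ConicSet d}

/-- `ψ` is invariant under the simultaneous rotation of the cone and of the conic set. -/
def IsRotationInvariant (ψ : PolyhedralCone d → ConicSet d → ℝ) : Prop :=
  ∀ (Q : E d ≃ₗᵢ[ℝ] E d) C M, ψ (C.rotate Q) (M.rotate Q) = ψ C M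

/-- `ψ C M` depends only on the traces on `M` of the skeletons of `C`. -/
def IsLocallyDetermined (ψ : PolyhedralCone d → ConicSet d → ℝ) : Prop :=
  ∀ (C D : PolyhedralCone d) (M : ConicSet d),
    (∀ k ≤ d, C.skeleton k ∩ M.1 = D.skeleton k ∩ M.1) → ψ C M = ψ D M

theorem IsLocallyDetermined.apply_eq_apply_ofSubspace (hψ : IsLocallyDetermined ψ) {k : ℕ}
    (hL : L ∈ C.faceSpans k) (hM : M.1 ⊆ PolyhedralCone.relInterior L C.carrier) :
    ψ C M = ψ (.ofSubspace L) M := by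
  have hML : M.1 ⊆ PolyhedralCone.relInterior L (PolyhedralCone.ofSubspace L).carrier := by
    rw [PolyhedralCone.relInterior_ofSubspace]
    exact hM.trans fun x hx => (PolyhedralCone.relInterior_subset hx).2
  refine hψ _ _ _ fun j _ => ?_
  rw [PolyhedralCone.skeleton_inter_of_subset_relInterior hL hM,
    PolyhedralCone.skeleton_inter_of_subset_relInterior
      (PolyhedralCone.mem_faceSpans_ofSubspace L) hML, hL.2]

theorem IsRotationInvariant.apply_ofSubspace_congr (hψ : IsRotationInvariant ψ)
    (hM : ∀ Q, M.rotate Q = M) (h : Module.finrank ℝ L = Module.finrank ℝ L') :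
    ψ (.ofSubspace L) M = ψ (.ofSubspace L') M := by
  obtain ⟨Q, hQ⟩ := exists_linearIsometryEquiv_map_eq h
  rw [← hψ Q, PolyhedralCone.rotate_ofSubspace, hQ, hM]

theorem IsRotationInvariant.apply_ofSubspace_rotate (hψ : IsRotationInvariant ψ)
    {Q : E d ≃ₗᵢ[ℝ] E d} (hQ : L.map (Q.toLinearEquiv : E d →ₗ[ℝ] E d) = L) (M : ConicSet d) :
    ψ (.ofSubspace L) (M.rotate Q) = ψ (.ofSubspace L) M := by
  conv_lhs => rw [← hQ, ← PolyhedralCone.rotate_ofSubspace, hψ]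

theorem apply_relInterior_inter_punctured (hmeas : ∀ C, IsConicMeasure (ψ C))
    (hconc : ∀ C, IsConcentratedOn (ψ C) C) (hinv : IsRotationInvariant ψ)
    (hloc : IsLocallyDetermined ψ) {k : ℕ} (hk : 1 ≤ k) (hL : L ∈ C.faceSpans k) (M : ConicSet d) :
    ψ C ((M.inter (.relInterior L C)).inter (.punctured d)) =
      ψ (.ofSubspace L) (.punctured d) * (gaussianOn L).real (C.carrier ∩ L ∩ M.1) := by
  have hsub : ((M.inter (.relInterior L C)).inter (.punctured d)).1 ⊆
      PolyhedralCone.relInterior L C.carrier := fun x hx => hx.1.2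
  rw [hloc.apply_eq_apply_ofSubspace hL hsub,
    (hmeas _).apply_inter_punctured_eq_mul_gaussianOn
      (PolyhedralCone.ne_bot_of_mem_faceSpans hL hk) (hconc _)
      fun Q hQ => hinv.apply_ofSubspace_rotate hQ]
  congr 1
  refine measureReal_congr ?_
  rw [Set.inter_comm (C.carrier ∩ L)]
  exact (ae_eq_refl M.1).inter (inter_ae_eq_relInterior C L).symm

theorem apply_origin_eq (hinv : IsRotationInvariant ψ) (hloc : IsLocallyDetermined ψ)
    (h : Module.finrank ℝ L = C.lin) : ψ C (.origin d) = ψ (.ofSubspace L) (.origin d) := by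
  rw [hloc.apply_eq_apply_ofSubspace C.lineal_mem_faceSpans
    (Set.singleton_subset_iff.2 C.zero_mem_relInterior_lineal)]
  exact hinv.apply_ofSubspace_congr ConicSet.rotate_origin h.symm

theorem sum_mul_linMeasure (c : ℕ → ℝ) (C : PolyhedralCone d) (M : ConicSet d) :
    ∑ k ∈ Finset.Icc 0 d, c k * linMeasure k C M =
      c C.lin * (Measure.dirac (0 : E d)).real M.1 := by
  have hlin : C.lin ∈ Finset.Icc 0 d :=
    Finset.mem_Icc.2 ⟨Nat.zero_le _, PolyhedralCone.le_of_mem_faceSpans C.lineal_mem_faceSpans⟩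
  rw [Finset.sum_eq_single_of_mem C.lin hlin, linMeasure, if_pos rfl, one_mul]
  intro k _ hk
  rw [linMeasure, if_neg hk.symm, zero_mul, mul_zero]

theorem eq_sum_linMeasure_add_sum_polyMeasure (hmeas : ∀ C, IsConicMeasure (ψ C))
    (hconc : ∀ C, IsConcentratedOn (ψ C) C) (hinv : IsRotationInvariant ψ)
    (hloc : IsLocallyDetermined ψ) {L : ℕ → Submodule ℝ (E d)}
    (hL : ∀ k ≤ d, Module.finrank ℝ (L k) = k) :
    ψ = ∑ k ∈ Finset.Icc 0 d, ψ (.ofSubspace (L k)) (.origin d) • linMeasure k +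
      ∑ k ∈ Finset.Icc 1 d, ψ (.ofSubspace (L k)) (.punctured d) • polyMeasure k := by
  funext C M
  simp only [Pi.add_apply, Finset.sum_apply, Pi.smul_apply, smul_eq_mul]
  have hlin : C.lin ≤ d := PolyhedralCone.le_of_mem_faceSpans C.lineal_mem_faceSpans
  rw [← (hmeas C).apply_inter_origin_add_inter_punctured M, (hmeas C).apply_inter_origin,
    apply_origin_eq hinv hloc (hL C.lin hlin),
    sum_mul_linMeasure fun k => ψ (.ofSubspace (L k)) (.origin d),
    (hmeas C).apply_inter_punctured_eq_sum (hconc C)]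
  congr 1
  refine Finset.sum_congr rfl fun k hk => ?_
  rw [polyMeasure, Finset.mul_sum]
  refine Finset.sum_congr rfl fun F hF => ?_
  rw [Set.Finite.mem_toFinset] at hF
  rw [Finset.mem_Icc] at hk
  rw [apply_relInterior_inter_punctured hmeas hconc hinv hloc hk.1 hF,
    hinv.apply_ofSubspace_congr ConicSet.rotate_punctured (hF.2.trans (hL k hk.2).symm)]

end ConicFunctional

end Conic

end

theorem mainTheorem5 (d : ℕ) (ψ : Conic.PolyhedralCone d → Conic.ConicSet d → ℝ)
    (measure : ∀ C, Conic.IsConicMeasure (ψ C))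
    (concentration : ∀ C M, ψ C M = ψ C (M.interCone C))
    (invariance : ∀ (Q : Conic.E d ≃ₗᵢ[ℝ] Conic.E d) C M, ψ (C.rotate Q) (M.rotate Q) = ψ C M)
    (locality : ∀ (C D : Conic.PolyhedralCone d) (M : Conic.ConicSet d),
      (∀ k ≤ d, C.skeleton k ∩ M.1 = D.skeleton k ∩ M.1) → ψ C M = ψ D M) :
    -- `Lin_0 = Ψ_0`, and `ψ` is a linear combination of `Lin_0, …, Lin_d, Ψ_1, …, Ψ_d`
    Conic.linMeasure (d := d) 0 = Conic.polyMeasure 0 ∧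
    ψ ∈ Submodule.span ℝ
      (Conic.linMeasure '' Set.Icc 0 d ∪ Conic.polyMeasure '' Set.Icc 1 d) ∧
    -- explicitly, for any choice of subspaces `L k` of dimension `k`
    ∀ L : ℕ → Submodule ℝ (Conic.E d), (∀ k ≤ d, Module.finrank ℝ (L k) = k) →
      ψ = ∑ k ∈ Finset.Icc 0 d,
            ψ (.ofSubspace (L k)) (.origin d) • Conic.linMeasure k +
          ∑ k ∈ Finset.Icc 1 d,
            ψ (.ofSubspace (L k)) (.punctured d) • Conic.polyMeasure k := by
  have heq (L : ℕ → Submodule ℝ (Conic.E d)) (hL : ∀ k ≤ d, Module.finrank ℝ (L k) = k) :=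
    Conic.eq_sum_linMeasure_add_sum_polyMeasure measure concentration invariance locality hL
  refine ⟨Conic.linMeasure_zero_eq_polyMeasure_zero, ?_, heq⟩
  have hexists (k : ℕ) (hk : k ≤ d) : ∃ L : Submodule ℝ (Conic.E d), Module.finrank ℝ L = k :=
    Conic.exists_submodule_finrank_eq (hk.trans_eq finrank_euclideanSpace_fin.symm)
  choose! L hL using hexists
  rw [heq L hL]
  refine add_mem (sum_mem fun k hk => ?_) (sum_mem fun k hk => ?_)
  · exact Submodule.smul_mem _ _ <| Submodule.subset_span <|
      .inl ⟨k, Finset.mem_Icc.1 hk, rfl⟩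
  · exact Submodule.smul_mem _ _ <| Submodule.subset_span <|
      .inr ⟨k, Finset.mem_Icc.1 hk, rfl⟩
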